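/- Let $\mathbb K\in\{\mathbb R,\mathbb C\}$ and let $\Omega$ be a Hausdorff $k_{\mathbb R}$-space, i.e. a completely regular Hausdorff space such that every function $f\colon\Omega\to\mathbb R$ whose restriction to each compact subset of $\Omega$ is continuous is itself continuous. Assume that $\Omega$ is hemicompact (there are compact sets $K_1,K_2,\dots\subset\Omega$ such that every compact subset of $\Omega$ is contained in some $K_n$) or Polish (separable and completely metrisable). Let $\mathrm C_{\mathrm b}(\Omega)$ be the Banach space of bounded continuous functions $\Omega\to\mathbb K$ with the supremum norm $\|\cdot\|_\infty$. Let $\tau_{\mathrm{co}}$ be the compact-open topology on it, given by the seminorms $p_K(f)=\sup_{x\in K}|f(x)|$, $K\subset\Omega$ compact. Let $\beta_0$ be the topology given by the seminorms $|f|_\nu=\sup_{x\in\Omega}|f(x)|\nu(x)$, where $\nu\colon\Omega\to[0,\infty)$ ranges over the bounded functions for which $\{x\in\Omega:\nu(x)\ge\varepsilon\}$ is compact for every $\varepsilon>0$. Let $(T(t))_{t\ge0}$ be a $\tau_{\mathrm{co}}$-bi-continuous semigroup on $\mathrm C_{\mathrm b}(\Omega)$, i.e. a family of $\|\cdot\|_\infty$-bounded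 linear operators on $\mathrm C_{\mathrm b}(\Omega)$ such that 1. $T(0)=\mathrm{id}$ and $T(t+s)=T(t)T(s)$ for all $t,s\ge0$; 2. $t\mapsto T(t)f$ is continuous from $[0,\infty)$ to $(\mathrm C_{\mathrm b}(\Omega),\tau_{\mathrm{co}})$ for every $f$; 3. there are $M\ge1$ and $\omega\in\mathbb R$ with $\|T(t)\|\le Me^{\omega t}$ for all $t\ge0$; 4. whenever $(f_n)_{n\in\mathbb N}$ is $\|\cdot\|_\infty$-bounded and $\tau_{\mathrm{co}}$-convergent to $f\in\mathrm C_{\mathrm b}(\Omega)$, then $T(t)(f_n-f)\to0$ in $\tau_{\mathrm{co}}$, uniformly for $t\in[0,t_0]$, for every $t_0\ge0$. Then $(T(t))_{t\ge0}$ is - quasi-$\beta_0$-equicontinuous: there is $\alpha\in\mathbb R$ such that the family $(e^{-\alpha t}T(t))_{t\ge0}$ is equicontinuous on $(\mathrm C_{\mathrm b}(\Omega),\beta_0)$; and - quasi-$(\|\cdot\|_\infty,\tau_{\mathrm{co}})$-equitight: there is $\alpha\in\mathbb R$ such that for all $\varepsilon>0$ and all compact $K\subset\Omega$ there are a compact $L\subset\Omega$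 and $C\ge0$ with $$p_K(e^{-\alpha t}T(t)f)\le C\,p_L(f)+\varepsilon\|f\|_\infty\qquad\text{for all }t\ge0,\ f\in\mathrm C_{\mathrm b}(\Omega).$$ -/

import Mathlib

open Filter Topology BoundedContinuousFunction
open scoped NNReal

/-- A `k_ℝ`-space: a completely regular space on which every real-valued function whose
restriction to each compact set is continuous is already continuous. -/
structure IsKRSpace (Ω : Type*) [TopologicalSpace Ω] : Prop where
  completelyRegular : CompletelyRegularSpace Ω
  continuous_of_continuousOn_compact :
    ∀ f : Ω → ℝ, (∀ K : Set Ω, IsCompact K → ContinuousOn f K) → Continuous f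

/-- Hemicompactness (for Hausdorff spaces): there is a sequence of compact sets such that every
compact set is contained in one of them. -/
def IsHemicompact (Ω : Type*) [TopologicalSpace Ω] : Prop :=
  ∃ K : ℕ → Set Ω, (∀ n, IsCompact (K n)) ∧ ∀ L : Set Ω, IsCompact L → ∃ N, L ⊆ K N

section SeminormTopology

variable {𝕜 X ι : Type*} [RCLike 𝕜] [AddCommGroup X] [Module 𝕜 X]

/-- The locally convex topology induced by a family of seminorms. -/
abbrev seminormTopology (p : SeminormFamily 𝕜 X ι) : TopologicalSpace X :=
  p.moduleFilterBasis.topology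

end SeminormTopology

section Semigroups

/-- `T` is a `τ`-bi-continuous semigroup on the normed space `X`. The operators `T t` are continuous
for the norm topology; `τ` is a second topology on `X`. -/
structure IsBiContinuousSemigroup {𝕜 X : Type*} [RCLike 𝕜] [NormedAddCommGroup X]
    [NormedSpace 𝕜 X] (T : ℝ≥0 → X →L[𝕜] X) (τ : TopologicalSpace X) : Prop where
  map_zero : ∀ x : X, T 0 x = x
  map_add : ∀ (t s : ℝ≥0) (x : X), T (t + s) x = T t (T s x)
  /-- `τ`-strong continuity -/
  strong_continuous : ∀ x : X, @Continuous ℝ≥0 X _ τ (fun t => T t x)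
  /-- exponential boundedness in operator norm -/
  exp_bounded : ∃ M : ℝ, 1 ≤ M ∧ ∃ ω : ℝ, ∀ t : ℝ≥0, ‖T t‖ ≤ M * Real.exp (ω * t)
  /-- local bi-equicontinuity: along norm-bounded `τ`-convergent sequences `u n → x` one has
  `T t (u n - x) → 0` in `τ`, uniformly for `t` in each interval `[0, t₀]` -/
  locally_biequicontinuous : ∀ (u : ℕ → X) (x : X), (∃ C : ℝ, ∀ n, ‖u n‖ ≤ C) →
    Tendsto u atTop (@nhds X τ x) →
    ∀ t₀ : ℝ≥0, ∀ U ∈ @nhds X τ 0, ∀ᶠ n in atTop, ∀ t : ℝ≥0, t ≤ t₀ → T t (u n - x) ∈ U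

/-- Equicontinuity, for the topology `τ`, of a family of linear maps: for every point `x` and every
`τ`-neighbourhood `U` of zero there is a `τ`-neighbourhood `V` of `x` with
`T t '' V ⊆ T t x + U` for all indices `t`. -/
def IsEquicontinuousFamily {𝕜 X I : Type*} [RCLike 𝕜] [AddCommGroup X] [Module 𝕜 X]
    (T : I → X →ₗ[𝕜] X) (τ : TopologicalSpace X) : Prop :=
  ∀ x : X, ∀ U ∈ @nhds X τ 0, ∃ V ∈ @nhds X τ x, ∀ t : I, ∀ y ∈ V, T t y - T t x ∈ U

/-- Equitightness of a family of linear maps with respect to the norm and the topology generated by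
the directed family of seminorms `p`. -/
def IsEquitight {𝕜 X ι I : Type*} [RCLike 𝕜] [NormedAddCommGroup X] [NormedSpace 𝕜 X]
    (p : SeminormFamily 𝕜 X ι) (T : I → X →ₗ[𝕜] X) : Prop :=
  ∀ ε : ℝ, 0 < ε → ∀ i : ι, ∃ j : ι, ∃ C : ℝ, 0 ≤ C ∧
    ∀ (t : I) (x : X), p i (T t x) ≤ C * p j x + ε * ‖x‖

/-- The rescaled family `(e^{-α t} T t)_{t ≥ 0}`. -/
noncomputable def rescaledFamily {𝕜 X : Type*} [RCLike 𝕜] [AddCommGroup X] [Module 𝕜 X]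
    (α : ℝ) (T : ℝ≥0 → X →ₗ[𝕜] X) : ℝ≥0 → X →ₗ[𝕜] X :=
  fun t => ((Real.exp (-α * t) : ℝ) : 𝕜) • T t

/-- Quasi-equicontinuity for the topology `τ`. -/
def IsQuasiEquicontinuous {𝕜 X : Type*} [RCLike 𝕜] [AddCommGroup X] [Module 𝕜 X]
    (T : ℝ≥0 → X →ₗ[𝕜] X) (τ : TopologicalSpace X) : Prop :=
  ∃ α : ℝ, IsEquicontinuousFamily (rescaledFamily α T) τ

/-- Quasi-equitightness with respect to the norm and the topology generated by the directed family
of seminorms `p`. -/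
def IsQuasiEquitight {𝕜 X ι : Type*} [RCLike 𝕜] [NormedAddCommGroup X] [NormedSpace 𝕜 X]
    (p : SeminormFamily 𝕜 X ι) (T : ℝ≥0 → X →ₗ[𝕜] X) : Prop :=
  ∃ α : ℝ, IsEquitight p (rescaledFamily α T)

end Semigroups

section Cb

/-- The seminorm `f ↦ sup_{x ∈ S} ‖f x‖ * ν x` for a set `S` and a bounded non-negative weight `ν`.
The supremum is over a bounded set of non-negative reals; over the empty set it is `0`. -/
noncomputable def weightedSupSeminorm (Ω 𝕜 : Type*) [TopologicalSpace Ω] [RCLike 𝕜]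
    (S : Set Ω) (ν : Ω → ℝ) (hν : ∀ x, 0 ≤ ν x) (hb : ∃ C : ℝ, ∀ x, ν x ≤ C) :
    Seminorm 𝕜 (Ω →ᵇ 𝕜) :=
  have bdd : ∀ f : Ω →ᵇ 𝕜, BddAbove (Set.range fun x : S => ‖f x‖ * ν x) := by
    obtain ⟨C, hC⟩ := hb
    rintro f
    refine ⟨‖f‖ * C, ?_⟩
    rintro _ ⟨x, rfl⟩
    exact mul_le_mul (f.norm_coe_le_norm x) (hC x) (hν x) (norm_nonneg f)
  have nonneg : ∀ f : Ω →ᵇ 𝕜, 0 ≤ ⨆ x : S, ‖f x‖ * ν x := fun f =>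
    Real.iSup_nonneg fun x => mul_nonneg (norm_nonneg _) (hν x)
  Seminorm.of (fun f : Ω →ᵇ 𝕜 => ⨆ x : S, ‖f x‖ * ν x)
    (fun f g => by
      refine Real.iSup_le (fun x => ?_) (add_nonneg (nonneg f) (nonneg g))
      calc ‖(f + g) x‖ * ν x ≤ (‖f x‖ + ‖g x‖) * ν x :=
            mul_le_mul_of_nonneg_right (norm_add_le _ _) (hν x)
        _ = ‖f x‖ * ν x + ‖g x‖ * ν x := add_mul _ _ _
        _ ≤ _ := add_le_add (le_ciSup (bdd f) x) (le_ciSup (bdd g) x))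
    (fun a f => by
      rw [Real.mul_iSup_of_nonneg (norm_nonneg a)]
      simp only [BoundedContinuousFunction.coe_smul, smul_eq_mul, norm_mul, mul_assoc])

/-- The directed family of seminorms `p_K(f) = sup_{x ∈ K} ‖f x‖`, `K` compact. -/
noncomputable def coSeminorms (Ω 𝕜 : Type*) [TopologicalSpace Ω] [RCLike 𝕜] :
    SeminormFamily 𝕜 (Ω →ᵇ 𝕜) (TopologicalSpace.Compacts Ω) :=
  fun K => weightedSupSeminorm Ω 𝕜 (K : Set Ω) (fun _ => 1) (fun _ => zero_le_one)
    ⟨1, fun _ => le_rfl⟩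

/-- The compact-open topology `τ_co` on `C_b(Ω)`. -/
noncomputable abbrev coTopology (Ω 𝕜 : Type*) [TopologicalSpace Ω] [RCLike 𝕜] :
    TopologicalSpace (Ω →ᵇ 𝕜) :=
  seminormTopology (coSeminorms Ω 𝕜)

/-- The set of non-negative bounded functions on `Ω` that vanish at infinity; no continuity is
required. -/
def vanishingWeights (Ω : Type*) [TopologicalSpace Ω] : Set (Ω → ℝ) :=
  {ν | (∀ x, 0 ≤ ν x) ∧ (∃ C : ℝ, ∀ x, ν x ≤ C) ∧ ∀ ε : ℝ, 0 < ε → IsCompact {x | ε ≤ ν x}}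

/-- The seminorms `|f|_ν = sup_{x ∈ Ω} ‖f x‖ * ν x`, for weights `ν` vanishing at infinity. -/
noncomputable def strictSeminorms (Ω 𝕜 : Type*) [TopologicalSpace Ω] [RCLike 𝕜] :
    SeminormFamily 𝕜 (Ω →ᵇ 𝕜) (vanishingWeights Ω) :=
  fun ν => weightedSupSeminorm Ω 𝕜 Set.univ ν.1 ν.2.1 ν.2.2.1

/-- The strict topology `β₀` on `C_b(Ω)`. -/
noncomputable abbrev strictTopology (Ω 𝕜 : Type*) [TopologicalSpace Ω] [RCLike 𝕜] :
    TopologicalSpace (Ω →ᵇ 𝕜) :=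
  seminormTopology (strictSeminorms Ω 𝕜)

end Cb

/-! Everything reduces to tightness on bounded time intervals, `IsUniformlyTight`: on a compact set
K, `T t f` is small relative to `‖f‖` once f vanishes on a suitable compact L. Bi-continuity only
gives a statement about sequences, `IsSequentiallyTight`.

In the hemicompact case, a failure of tightness along an exhaustion yields a forbidden sequence. In
the Polish case the same argument runs along finite unions of balls. These are not compact, but
intersecting slightly larger unions over all radii gives a compact set, and a telescoping
decomposition of f adds up the errors.

Rescaling by `ω + 1` makes the operator norms decay, so tightness extends to all times. Truncating f
at height `p_L(f)` then gives equitightness. Truncating at the heights `δ * 2 ^ k` and summing the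
layers gives β₀-equicontinuity. -/

/-! ### Pointwise bounds and weighted suprema -/

section Estimates

variable {Ω 𝕜 : Type*} [RCLike 𝕜] [TopologicalSpace Ω]

theorem weightedSupSeminorm_apply {S : Set Ω} {ν : Ω → ℝ} (hν : ∀ x, 0 ≤ ν x)
    (hb : ∃ C : ℝ, ∀ x, ν x ≤ C) (f : Ω →ᵇ 𝕜) :
    weightedSupSeminorm Ω 𝕜 S ν hν hb f = ⨆ x : S, ‖f x‖ * ν x := rfl

theorem norm_mul_le_weightedSupSeminorm {S : Set Ω} {ν : Ω → ℝ} (hν : ∀ x, 0 ≤ ν x)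
    (hb : ∃ C : ℝ, ∀ x, ν x ≤ C) (f : Ω →ᵇ 𝕜) {x : Ω} (hx : x ∈ S) :
    ‖f x‖ * ν x ≤ weightedSupSeminorm Ω 𝕜 S ν hν hb f := by
  rw [weightedSupSeminorm_apply]
  have bdd : BddAbove (Set.range fun x : S => ‖f x‖ * ν x) := by
    obtain ⟨C, hC⟩ := hb
    refine ⟨‖f‖ * C, ?_⟩
    rintro _ ⟨x, rfl⟩
    exact mul_le_mul (f.norm_coe_le_norm x) (hC x) (hν x) (norm_nonneg f)
  exact le_ciSup bdd ⟨x, hx⟩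

theorem weightedSupSeminorm_le {S : Set Ω} {ν : Ω → ℝ} (hν : ∀ x, 0 ≤ ν x)
    (hb : ∃ C : ℝ, ∀ x, ν x ≤ C) {f : Ω →ᵇ 𝕜} {a : ℝ} (ha : 0 ≤ a)
    (h : ∀ x ∈ S, ‖f x‖ * ν x ≤ a) : weightedSupSeminorm Ω 𝕜 S ν hν hb f ≤ a := by
  rw [weightedSupSeminorm_apply]
  exact Real.iSup_le (fun x => h x x.2) ha

theorem norm_le_coSeminorms (K : TopologicalSpace.Compacts Ω) (f : Ω →ᵇ 𝕜) {x : Ω}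
    (hx : x ∈ K) : ‖f x‖ ≤ coSeminorms Ω 𝕜 K f := by
  have h := norm_mul_le_weightedSupSeminorm (S := (K : Set Ω)) (ν := fun _ => 1)
    (fun _ => zero_le_one) ⟨1, fun _ => le_rfl⟩ f hx
  rwa [mul_one] at h

theorem coSeminorms_le (K : TopologicalSpace.Compacts Ω) {f : Ω →ᵇ 𝕜} {a : ℝ} (ha : 0 ≤ a)
    (h : ∀ x ∈ K, ‖f x‖ ≤ a) : coSeminorms Ω 𝕜 K f ≤ a :=
  weightedSupSeminorm_le _ _ ha fun x hx => by simpa using h x hx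

end Estimates

/-! ### Neighbourhoods and equicontinuity through seminorms -/

section SeminormTopology

variable {𝕜 X ι : Type*} [RCLike 𝕜] [AddCommGroup X] [Module 𝕜 X]

theorem mem_nhds_seminormTopology (p : SeminormFamily 𝕜 X ι) (x : X) (U : Set X) :
    U ∈ @nhds X (seminormTopology p) x ↔ ∃ s : Finset ι, ∃ r > 0, (s.sup p).ball x r ⊆ U := by
  let := seminormTopology p
  have hp : WithSeminorms p := ⟨rfl⟩
  exact hp.mem_nhds_iff x U

theorem tendsto_nhds_seminormTopology {F : Type*} (p : SeminormFamily 𝕜 X ι) (u : F → X)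
    (l : Filter F) (y : X) :
    Tendsto u l (@nhds X (seminormTopology p) y) ↔
      ∀ i, ∀ ε : ℝ, 0 < ε → ∀ᶠ a in l, p i (u a - y) < ε := by
  let := seminormTopology p
  have hp : WithSeminorms p := ⟨rfl⟩
  exact hp.tendsto_nhds u y

theorem ball_mem_nhds_seminormTopology (p : SeminormFamily 𝕜 X ι) (x : X) (i : ι) {r : ℝ}
    (hr : 0 < r) : (p i).ball x r ∈ @nhds X (seminormTopology p) x := by
  rw [mem_nhds_seminormTopology]
  exact ⟨{i}, r, hr, by rw [Finset.sup_singleton]⟩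

/-- A family of linear maps is equicontinuous for the topology of a family of seminorms as soon as
each seminorm is controlled by a single one near zero, uniformly in the family. -/
theorem isEquicontinuousFamily_of_forall_exists {I : Type*} (p : SeminormFamily 𝕜 X ι)
    (T : I → X →ₗ[𝕜] X)
    (h : ∀ i, ∀ ε : ℝ, 0 < ε → ∃ j, ∃ δ : ℝ, 0 < δ ∧ ∀ t x, p j x < δ → p i (T t x) < ε) :
    IsEquicontinuousFamily T (seminormTopology p) := by
  intro x U hU
  obtain ⟨s, r, hr, hsU⟩ := (mem_nhds_seminormTopology p 0 U).1 hU
  choose j δ hδ hj using fun i => h i r hr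
  refine ⟨⋂ i ∈ s, (p (j i)).ball x (δ i), ?_, fun t y hy => hsU ?_⟩
  · exact (Filter.biInter_finset_mem s).2 fun i _ =>
      ball_mem_nhds_seminormTopology p x (j i) (hδ i)
  · rw [Seminorm.mem_ball_zero]
    refine Seminorm.finset_sup_apply_lt hr fun i hi => ?_
    rw [← map_sub]
    refine hj i t _ ?_
    exact (Seminorm.mem_ball _).1 (Set.mem_iInter₂.1 hy i hi)

end SeminormTopology

/-! ### Cutoffs and radial truncation -/

section Truncation

variable {Ω 𝕜 : Type*} [RCLike 𝕜] [TopologicalSpace Ω]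

/-- The product of a bounded continuous function with a continuous real-valued function that takes
values in `[0, 1]`. -/
noncomputable def cutoff (u : Ω → ℝ) (hu : Continuous u) (h : ∀ x, u x ∈ Set.Icc (0 : ℝ) 1)
    (f : Ω →ᵇ 𝕜) : Ω →ᵇ 𝕜 :=
  .ofNormedAddCommGroup (fun x => (u x : 𝕜) * f x) (by fun_prop) ‖f‖ fun x => by
    rw [norm_mul, RCLike.norm_ofReal, abs_of_nonneg (h x).1]
    exact (mul_le_of_le_one_left (norm_nonneg _) (h x).2).trans (f.norm_coe_le_norm x)

theorem cutoff_apply (u : Ω → ℝ) (hu : Continuous u) (h : ∀ x, u x ∈ Set.Icc (0 : ℝ) 1)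
    (f : Ω →ᵇ 𝕜) (x : Ω) : cutoff u hu h f x = (u x : 𝕜) * f x := rfl

/-- The radial truncation `f ↦ f * (r / max r |f|)` of a function to the ball of radius `r`. -/
noncomputable def radialTruncation (r : ℝ) (hr : 0 ≤ r) (f : Ω →ᵇ 𝕜) : Ω →ᵇ 𝕜 :=
  cutoff (fun x => r / max r ‖f x‖)
    (by
      -- At radius 0 the denominator may vanish, but the factor is then constantly 0.
      rcases hr.eq_or_lt with rfl | hr
      · simpa using continuous_const
      · exact continuous_const.div (by fun_prop) fun x => (lt_max_of_lt_left hr).ne')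
    (fun x => ⟨div_nonneg hr (hr.trans (le_max_left _ _)),
      div_le_one_of_le₀ (le_max_left _ _) (hr.trans (le_max_left _ _))⟩) f

theorem radialTruncation_apply (r : ℝ) (hr : 0 ≤ r) (f : Ω →ᵇ 𝕜) (x : Ω) :
    radialTruncation r hr f x = ((r / max r ‖f x‖ : ℝ) : 𝕜) * f x := rfl

theorem radialTruncation_apply_of_le {r : ℝ} (hr : 0 ≤ r) {f : Ω →ᵇ 𝕜} {x : Ω}
    (h : ‖f x‖ ≤ r) : radialTruncation r hr f x = f x := by
  rw [radialTruncation_apply, max_eq_left h]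
  rcases hr.eq_or_lt with rfl | hr
  · simp [norm_le_zero_iff.1 h]
  · simp [div_self hr.ne']

theorem norm_radialTruncation_le (r : ℝ) (hr : 0 ≤ r) (f : Ω →ᵇ 𝕜) :
    ‖radialTruncation r hr f‖ ≤ r := by
  refine (norm_le hr).2 fun x => ?_
  rw [radialTruncation_apply, norm_mul, RCLike.norm_ofReal,
    abs_of_nonneg (div_nonneg hr (hr.trans (le_max_left _ _))), div_mul_eq_mul_div]
  exact div_le_of_le_mul₀ (hr.trans (le_max_left _ _)) hr
    (mul_le_mul_of_nonneg_left (le_max_right _ _) hr)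

theorem norm_sub_cutoff_le (u : Ω → ℝ) (hu : Continuous u) (h : ∀ x, u x ∈ Set.Icc (0 : ℝ) 1)
    (f : Ω →ᵇ 𝕜) : ‖f - cutoff u hu h f‖ ≤ ‖f‖ := by
  refine (norm_le (norm_nonneg f)).2 fun x => ?_
  have e : (f - cutoff u hu h f) x = ((1 - u x : ℝ) : 𝕜) * f x := by
    simp [cutoff_apply]; ring
  rw [e, norm_mul, RCLike.norm_ofReal, abs_of_nonneg (sub_nonneg.2 (h x).2)]
  exact (mul_le_of_le_one_left (norm_nonneg _) (by linarith [(h x).1])).trans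
    (f.norm_coe_le_norm x)

theorem norm_sub_radialTruncation_le (r : ℝ) (hr : 0 ≤ r) (f : Ω →ᵇ 𝕜) :
    ‖f - radialTruncation r hr f‖ ≤ ‖f‖ :=
  norm_sub_cutoff_le _ _ _ f

end Truncation

/-! ### From sequential to uniform tightness, and equitightness -/

section Tightness

variable {Ω 𝕜 I : Type*} [RCLike 𝕜] [TopologicalSpace Ω]

/-- The family `S` is tight: on each compact set, functions vanishing on a large
compact set have uniformly small image, relative to their norm. -/
def IsUniformlyTight (S : I → (Ω →ᵇ 𝕜) →ₗ[𝕜] (Ω →ᵇ 𝕜)) : Prop :=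
  ∀ K : Set Ω, IsCompact K → ∀ ε : ℝ, 0 < ε → ∃ L : Set Ω, IsCompact L ∧
    ∀ (t : I) (f : Ω →ᵇ 𝕜), (∀ x ∈ L, f x = 0) → ∀ x ∈ K, ‖S t f x‖ ≤ ε * ‖f‖

/-- The family `S` maps bounded sequences converging to zero uniformly on compact sets to sequences
with the same property, uniformly in the family. -/
def IsSequentiallyTight (S : I → (Ω →ᵇ 𝕜) →ₗ[𝕜] (Ω →ᵇ 𝕜)) : Prop :=
  ∀ u : ℕ → Ω →ᵇ 𝕜, (∀ n, ‖u n‖ ≤ 1) →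
    (∀ K : Set Ω, IsCompact K → ∀ ε : ℝ, 0 < ε → ∀ᶠ n in atTop, ∀ x ∈ K, ‖u n x‖ ≤ ε) →
    ∀ K : Set Ω, IsCompact K → ∀ ε : ℝ, 0 < ε → ∀ᶠ n in atTop, ∀ t, ∀ x ∈ K, ‖S t (u n) x‖ ≤ ε

/-- Otherwise, normalised counterexamples vanishing on `A n` form a bounded sequence tending to zero
on compacts whose images stay large on K. The sets `A n` need not be compact, which the Polish case
exploits. -/
theorem IsSequentiallyTight.exists_of_exhaustion {S : I → (Ω →ᵇ 𝕜) →ₗ[𝕜] (Ω →ᵇ 𝕜)}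
    (hS : IsSequentiallyTight S) {A : ℕ → Set Ω}
    (hA : ∀ K, IsCompact K → ∀ᶠ n in atTop, K ⊆ A n) {K : Set Ω} (hK : IsCompact K) {ε : ℝ}
    (hε : 0 < ε) :
    ∃ n, ∀ (t : I) (f : Ω →ᵇ 𝕜), (∀ x ∈ A n, f x = 0) → ∀ x ∈ K, ‖S t f x‖ ≤ ε * ‖f‖ := by
  by_contra! hcon
  choose t f hf x hx hlt using hcon
  have hpos : ∀ n, 0 < ‖f n‖ := fun n => by
    refine norm_pos_iff.2 fun h0 => ?_
    have := hlt n
    simp [h0] at this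
  have key := hS (fun n => ((‖f n‖⁻¹ : ℝ) : 𝕜) • f n)
    (fun n => by
      rw [norm_smul, RCLike.norm_ofReal, abs_of_pos (inv_pos.2 (hpos n)),
        inv_mul_cancel₀ (hpos n).ne'])
    (fun L hL δ hδ => (hA L hL).mono fun n hn y hy => by simp [hf n y (hn hy), hδ.le])
    K hK ε hε
  obtain ⟨n, hn⟩ := key.exists
  have h1 := hn (t n) (x n) (hx n)
  rw [map_smul, BoundedContinuousFunction.smul_apply, norm_smul, RCLike.norm_ofReal,
    abs_of_pos (inv_pos.2 (hpos n)), inv_mul_le_iff₀ (hpos n)] at h1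
  linarith [hlt n, mul_comm ε ‖f n‖]

theorem IsSequentiallyTight.isUniformlyTight_of_isHemicompact
    {S : I → (Ω →ᵇ 𝕜) →ₗ[𝕜] (Ω →ᵇ 𝕜)} (hS : IsSequentiallyTight S) (hΩ : IsHemicompact Ω) :
    IsUniformlyTight S := by
  obtain ⟨A, hA, hcov⟩ := hΩ
  intro K hK ε hε
  -- The sets `A k` need not increase, hence the partial unions.
  obtain ⟨n, hn⟩ := hS.exists_of_exhaustion (A := fun n => ⋃ k ∈ Set.Iic n, A k)
    (fun L hL => by
      obtain ⟨N, hN⟩ := hcov L hL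
      filter_upwards [eventually_ge_atTop N] with n hn
      exact hN.trans (Set.subset_biUnion_of_mem (u := A) (Set.mem_Iic.2 hn)))
    hK hε
  exact ⟨_, (Set.finite_Iic n).isCompact_biUnion fun k _ => hA k, hn⟩

/-- The finite exceptional set F may depend on the scale; this lets the criterion apply to a
sequence that enters each union of balls only eventually. -/
theorem totallyBounded_of_subset_union_closedBall {Y : Type*} [PseudoMetricSpace Y] {s : Set Y}
    (c : ℕ → Y) (N : ℕ → ℕ)
    (h : ∀ j : ℕ, ∃ F : Set Y, F.Finite ∧
      s ⊆ F ∪ ⋃ i ∈ Set.Iio (N j), Metric.closedBall (c i) (2 / (j + 1))) :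
    TotallyBounded s := by
  refine Metric.totallyBounded_iff.2 fun ε hε => ?_
  obtain ⟨j, hj⟩ := exists_nat_one_div_lt (half_pos hε)
  obtain ⟨F, hF, hs⟩ := h j
  refine ⟨F ∪ c '' Set.Iio (N j), hF.union ((Set.finite_Iio _).image c), fun y hy => ?_⟩
  rcases hs hy with hy | hy
  · exact Set.mem_biUnion (Or.inl hy) (Metric.mem_ball_self hε)
  · obtain ⟨i, hi, hyi⟩ := Set.mem_iUnion₂.1 hy
    refine Set.mem_biUnion (Or.inr ⟨i, hi, rfl⟩) ?_
    refine Metric.mem_ball.2 ((Metric.mem_closedBall.1 hyi).trans_lt ?_)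
    have : (2 : ℝ) / (j + 1) = 2 * (1 / (j + 1)) := by ring
    linarith

/-- At scale j, finitely many balls of radius `1 / (j + 1)` suffice up to an error of order `ε / 2 ^
j`. Doubling the radii leaves room for Urysohn functions, which peel f into layers vanishing on
these balls, plus a remainder that becomes uniformly small. -/
theorem IsSequentiallyTight.isUniformlyTight_of_polishSpace [PolishSpace Ω]
    {S : I → (Ω →ᵇ 𝕜) →ₗ[𝕜] (Ω →ᵇ 𝕜)} (hS : IsSequentiallyTight S) {M : ℝ} (hM : 0 ≤ M)
    (hbd : ∀ t f, ‖S t f‖ ≤ M * ‖f‖) : IsUniformlyTight S := by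
  rcases isEmpty_or_nonempty Ω with hem | hne
  · exact fun K _ ε _ => ⟨∅, isCompact_empty, fun t f _ x => (hem.false x).elim⟩
  let := TopologicalSpace.upgradeIsCompletelyMetrizable Ω
  intro K hK ε hε
  set c := TopologicalSpace.denseSeq Ω with hc
  have hcov : ∀ r : ℝ, 0 < r → ∀ L : Set Ω, IsCompact L →
      ∀ᶠ n in atTop, L ⊆ ⋃ i ∈ Set.Iio n, Metric.ball (c i) r := by
    intro r hr L hL
    obtain ⟨s, hs⟩ := hL.elim_finite_subcover (fun i => Metric.ball (c i) r)
      (fun _ => Metric.isOpen_ball) (fun y _ => by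
        obtain ⟨i, hi⟩ := (TopologicalSpace.denseRange_denseSeq Ω).exists_dist_lt y hr
        exact Set.mem_iUnion.2 ⟨i, hi⟩)
    filter_upwards [eventually_gt_atTop (s.sup id)] with n hn
    refine hs.trans (Set.biUnion_mono (fun i hi => ?_) fun _ _ => subset_rfl)
    exact (Finset.le_sup (f := id) hi).trans_lt hn
  have hr : ∀ j : ℕ, (0 : ℝ) < 1 / (j + 1) := fun j => Nat.one_div_pos_of_nat
  -- These errors sum to `ε / 2`; the other half is for the remainder.
  choose N hN using fun j : ℕ => hS.exists_of_exhaustion (hcov _ (hr j)) hK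
    (show (0 : ℝ) < ε / 2 / 2 / 2 ^ j by positivity)
  set D : ℕ → Set Ω := fun j => ⋃ i ∈ Set.Iio (N j), Metric.closedBall (c i) (2 / (j + 1)) with hD
  have hDc : ∀ j, IsClosed (D j) := fun j =>
    (Set.finite_Iio _).isClosed_biUnion fun _ _ => Metric.isClosed_closedBall
  have hu : ∀ j : ℕ, ∃ u : C(Ω, ℝ),
      (∀ y ∈ ⋃ i ∈ Set.Iio (N j), Metric.ball (c i) (1 / (j + 1)), u y = 0) ∧
      (∀ y ∉ D j, u y = 1) ∧ ∀ y, u y ∈ Set.Icc (0 : ℝ) 1 := by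
    intro j
    have hlt : (1 : ℝ) / (j + 1) < 2 / (j + 1) := by
      rw [div_lt_div_iff_of_pos_right (by positivity)]; norm_num
    obtain ⟨u, h0, h1, h01⟩ := exists_continuous_zero_one_of_isClosed
      (s := ⋃ i ∈ Set.Iio (N j), Metric.closedBall (c i) (1 / (j + 1)))
      (t := (⋃ i ∈ Set.Iio (N j), Metric.ball (c i) (2 / (j + 1)))ᶜ)
      ((Set.finite_Iio _).isClosed_biUnion fun _ _ => Metric.isClosed_closedBall)
      (isOpen_biUnion fun _ _ => Metric.isOpen_ball).isClosed_compl
      (Set.disjoint_compl_right_iff_subset.2 (Set.biUnion_mono subset_rfl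
        fun _ _ => Metric.closedBall_subset_ball hlt))
    refine ⟨u, fun y hy => h0 ?_, fun y hy => h1 fun hy' => hy ?_, h01⟩
    · exact Set.biUnion_mono subset_rfl (fun _ _ => Metric.ball_subset_closedBall) hy
    · exact Set.biUnion_mono subset_rfl (fun _ _ => Metric.ball_subset_closedBall) hy'
  choose u hu0 hu1 hu01 using hu
  have hLc : IsCompact (⋂ j, D j) := by
    refine TotallyBounded.isCompact_of_isClosed ?_ (isClosed_iInter hDc)
    exact totallyBounded_of_subset_union_closedBall c N fun j =>
      ⟨∅, Set.finite_empty, fun y hy => Or.inr (Set.mem_iInter.1 hy j)⟩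
  refine ⟨⋂ j, D j, hLc, fun t f hf x hx => ?_⟩
  have hP01 : ∀ n y, ∏ j ∈ Finset.range n, (1 - u j y) ∈ Set.Icc (0 : ℝ) 1 := fun n y =>
    ⟨Finset.prod_nonneg fun j _ => sub_nonneg.2 (hu01 j y).2,
      Finset.prod_le_one (fun j _ => sub_nonneg.2 (hu01 j y).2)
        fun j _ => by linarith [(hu01 j y).1]⟩
  set g : ℕ → Ω →ᵇ 𝕜 := fun n =>
    cutoff (fun y => ∏ j ∈ Finset.range n, (1 - u j y)) (by fun_prop) (hP01 n) f with hg
  have hgx : ∀ n y, g n y = ((∏ j ∈ Finset.range n, (1 - u j y) : ℝ) : 𝕜) * f y :=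
    fun _ _ => rfl
  -- `g n` vanishes off `D j` for every j < n. Points where it stays above δ would therefore
  -- accumulate at a point of `⋂ j, D j`, where f vanishes.
  have hsmall : ∀ δ : ℝ, 0 < δ → ∃ n, ‖g n‖ ≤ δ := by
    intro δ hδ
    by_contra! hcon
    have hex : ∀ n, ∃ y, δ < ‖g n y‖ := fun n => by
      by_contra! h
      exact (hcon n).not_ge ((norm_le hδ.le).2 h)
    choose y hy using hex
    have hyD : ∀ n, ∀ j < n, y n ∈ D j := by
      intro n j hj
      by_contra hnot
      have h0 : ∏ j ∈ Finset.range n, (1 - u j (y n)) = 0 :=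
        Finset.prod_eq_zero (Finset.mem_range.2 hj) (by rw [hu1 j _ hnot, sub_self])
      have := hy n
      rw [hgx, h0] at this
      simp at this
      linarith
    have hyf : ∀ n, δ < ‖f (y n)‖ := fun n => by
      refine (hy n).trans_le ?_
      rw [hgx, norm_mul, RCLike.norm_ofReal, abs_of_nonneg (hP01 n _).1]
      exact mul_le_of_le_one_left (norm_nonneg _) (hP01 n _).2
    have htb : TotallyBounded (Set.range y) := by
      refine totallyBounded_of_subset_union_closedBall c N fun j =>
        ⟨y '' Set.Iic j, (Set.finite_Iic j).image y, ?_⟩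
      rintro _ ⟨n, rfl⟩
      rcases le_or_gt n j with h | h
      · exact Or.inl ⟨n, h, rfl⟩
      · exact Or.inr (hyD n j h)
    have hcpt : IsCompact (closure (Set.range y)) :=
      htb.closure.isCompact_of_isClosed isClosed_closure
    obtain ⟨a, -, φ, hφ, hlim⟩ :=
      hcpt.tendsto_subseq fun n => subset_closure (Set.mem_range_self n)
    have haD : a ∈ ⋂ j, D j := Set.mem_iInter.2 fun j =>
      (hDc j).mem_of_tendsto hlim ((eventually_gt_atTop j).mono fun n hn =>
        hyD _ _ (hn.trans_le (hφ.id_le n)))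
    have hfa : δ ≤ ‖f a‖ := ge_of_tendsto
      ((f.continuous.norm.tendsto a).comp hlim) (Eventually.of_forall fun n => (hyf _).le)
    rw [hf a haD, norm_zero] at hfa
    linarith
  -- The factor `u j` in this layer vanishes on the balls chosen at scale j.
  have hlayer : ∀ j, ‖S t (g j - g (j + 1)) x‖ ≤ ε / 2 / 2 / 2 ^ j * ‖f‖ := by
    intro j
    have e : ∀ y, (g j - g (j + 1)) y =
        ((∏ i ∈ Finset.range j, (1 - u i y) : ℝ) : 𝕜) * (u j y : 𝕜) * f y := fun y => by
      rw [BoundedContinuousFunction.sub_apply, hgx, hgx, Finset.prod_range_succ]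
      push_cast
      ring
    refine (hN j t _ (fun y hy => by rw [e, hu0 j y hy]; simp) x hx).trans ?_
    refine mul_le_mul_of_nonneg_left ((norm_le (norm_nonneg f)).2 fun y => ?_) (by positivity)
    rw [e, norm_mul, norm_mul, RCLike.norm_ofReal, RCLike.norm_ofReal,
      abs_of_nonneg (hP01 j y).1, abs_of_nonneg (hu01 j y).1]
    exact (mul_le_of_le_one_left (norm_nonneg _)
      (mul_le_one₀ (hP01 j y).2 (hu01 j y).1 (hu01 j y).2)).trans (f.norm_coe_le_norm y)
  rcases (norm_nonneg f).eq_or_lt with h0 | hfpos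
  · have : f = 0 := norm_eq_zero.1 h0.symm
    simp [this]
  -- `M + 1` keeps the denominator positive when M is 0.
  obtain ⟨n, hn⟩ := hsmall (ε / 2 * ‖f‖ / (M + 1)) (by positivity)
  have hdec : f = ∑ j ∈ Finset.range n, (g j - g (j + 1)) + g n := by
    have h0 : g 0 = f := by ext y; simp [hgx]
    rw [Finset.sum_range_sub', h0, sub_add_cancel]
  have hrest : ‖S t (g n) x‖ ≤ ε / 2 * ‖f‖ := by
    refine (((S t (g n)).norm_coe_le_norm x).trans (hbd t _)).trans ?_
    calc M * ‖g n‖ ≤ (M + 1) * (ε / 2 * ‖f‖ / (M + 1)) := by gcongr; linarith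
      _ = ε / 2 * ‖f‖ := by field_simp
  have hsum : ‖∑ j ∈ Finset.range n, S t (g j - g (j + 1)) x‖ ≤ ε / 2 * ‖f‖ := by
    refine (norm_sum_le_of_le _ fun j _ => hlayer j).trans ?_
    rw [← Finset.sum_mul]
    refine mul_le_mul_of_nonneg_right ?_ (norm_nonneg f)
    exact (summable_geometric_two' (ε / 2)).sum_le_tsum _ (fun j _ => by positivity) |>.trans
      (tsum_geometric_two' (ε / 2)).le
  calc ‖S t f x‖ = ‖∑ j ∈ Finset.range n, S t (g j - g (j + 1)) x + S t (g n) x‖ := by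
        conv_lhs => rw [hdec, map_add, map_sum]
        simp
    _ ≤ ε / 2 * ‖f‖ + ε / 2 * ‖f‖ := (norm_add_le _ _).trans (add_le_add hsum hrest)
    _ = ε * ‖f‖ := by ring

/-- Truncated at height `p_L(f)`, f is unchanged on L: the truncation is handled by the operator
bound, the difference by tightness. -/
theorem IsUniformlyTight.isEquitight {S : I → (Ω →ᵇ 𝕜) →ₗ[𝕜] (Ω →ᵇ 𝕜)}
    (hS : IsUniformlyTight S) {M : ℝ} (hM : 0 ≤ M) (hbd : ∀ t f, ‖S t f‖ ≤ M * ‖f‖) :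
    IsEquitight (coSeminorms Ω 𝕜) S := by
  intro ε hε K
  obtain ⟨L, hL, h⟩ := hS K K.isCompact ε hε
  refine ⟨⟨L, hL⟩, M, hM, fun t f => ?_⟩
  set r := coSeminorms Ω 𝕜 ⟨L, hL⟩ f
  have hr : 0 ≤ r := apply_nonneg _ _
  refine coSeminorms_le K (by positivity) fun x hx => ?_
  have h1 := h t (f - radialTruncation r hr f) (fun y hy => by
    rw [BoundedContinuousFunction.sub_apply, radialTruncation_apply_of_le hr
      (norm_le_coSeminorms ⟨L, hL⟩ f hy), sub_self]) x hx
  have h2 : ‖S t (radialTruncation r hr f) x‖ ≤ M * r :=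
    (((S t _).norm_coe_le_norm x).trans (hbd t _)).trans
      (mul_le_mul_of_nonneg_left (norm_radialTruncation_le r hr f) hM)
  calc ‖S t f x‖ = ‖S t (radialTruncation r hr f) x + S t (f - radialTruncation r hr f) x‖ := by
        rw [← BoundedContinuousFunction.add_apply, ← map_add, add_sub_cancel]
    _ ≤ M * r + ε * ‖f‖ := (norm_add_le _ _).trans (add_le_add h2
        (h1.trans (mul_le_mul_of_nonneg_left (norm_sub_radialTruncation_le r hr f) hε.le)))

end Tightness

/-! ### Equicontinuity for the strict topology -/

section Strict

variable {Ω 𝕜 I : Type*} [RCLike 𝕜] [TopologicalSpace Ω]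

/-- For a sequence of compact sets and a positive scale `δ` there is a weight vanishing at
infinity that dominates `1 / (δ * 2 ^ k)` on the `k`-th compact set. -/
theorem exists_vanishingWeight_ge [T2Space Ω] (L : ℕ → Set Ω) (hL : ∀ k, IsCompact (L k)) {δ : ℝ}
    (hδ : 0 < δ) :
    ∃ μ ∈ vanishingWeights Ω, ∀ k, ∀ x ∈ L k, (δ * 2 ^ k)⁻¹ ≤ μ x := by
  classical
  set a : ℕ → ℝ := fun k => (δ * 2 ^ k)⁻¹ with ha
  have ha0 : ∀ k, 0 < a k := fun k => by positivity
  have hanti : Antitone a := antitone_nat_of_succ_le fun k => by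
    simp only [ha]
    gcongr
    · norm_num
    · omega
  have hlim : Tendsto a atTop (𝓝 0) :=
    tendsto_inv_atTop_zero.comp
      ((tendsto_pow_atTop_atTop_of_one_lt one_lt_two).const_mul_atTop hδ)
  set s : Ω → ℕ → ℝ := fun x k => (L k).indicator (fun _ => a k) x with hs
  have hs0 : ∀ x k, 0 ≤ s x k := fun x k => Set.indicator_nonneg (fun _ _ => (ha0 k).le) x
  have hsa : ∀ x k, s x k ≤ a k := fun x k => Set.indicator_le_self' (fun _ _ => (ha0 k).le) x
  have hbdd : ∀ x, BddAbove (Set.range (s x)) := fun x => ⟨a 0, by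
    rintro _ ⟨k, rfl⟩
    exact (hsa x k).trans (hanti (Nat.zero_le k))⟩
  have hge : ∀ k, ∀ x ∈ L k, a k ≤ ⨆ k, s x k := fun k x hx => by
    refine le_ciSup_of_le (hbdd x) k ?_
    simp [hs, hx]
  refine ⟨fun x => ⨆ k, s x k, ⟨fun x => Real.iSup_nonneg (hs0 x), ⟨a 0, fun x =>
    Real.iSup_le (fun k => (hsa x k).trans (hanti (Nat.zero_le k))) (ha0 0).le⟩, ?_⟩, hge⟩
  intro ε hε
  have hex : ∃ n, a n < ε := (hlim.eventually_lt_const hε).exists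
  have hmin : ∀ k < Nat.find hex, ε ≤ a k := fun k hk => not_lt.1 (Nat.find_min hex hk)
  -- Since `a` decreases, only the sets before the first index with `a n < ε` can contribute.
  have hset : {x | ε ≤ ⨆ k, s x k} = ⋃ k ∈ Set.Iio (Nat.find hex), L k := by
    ext x
    simp only [Set.mem_ofPred_eq, Set.mem_iUnion, Set.mem_Iio, exists_prop]
    refine ⟨fun h => ?_, fun ⟨k, hk, hx⟩ => (hmin k hk).trans (hge k x hx)⟩
    by_contra! hcon
    refine (Nat.find_spec hex).not_ge (h.trans (Real.iSup_le (fun k => ?_) (ha0 _).le))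
    rcases lt_or_ge k (Nat.find hex) with hk | hk
    · simpa [hs, hcon k hk] using (ha0 _).le
    · exact (hsa x k).trans (hanti hk)
  rw [hset]
  exact (Set.finite_Iio _).isCompact_biUnion fun k _ => hL k

/-- Either the weight is at least `(1 / 4) ^ k` and tightness gains this factor, or the weight
itself supplies it. Against a layer of size `2 ^ k`, a summable `1 / 2 ^ k` remains. -/
theorem norm_apply_mul_weight_le {S : I → (Ω →ᵇ 𝕜) →ₗ[𝕜] (Ω →ᵇ 𝕜)} {M C : ℝ}
    (hM : 0 ≤ M) (hC : 0 ≤ C) (hbd : ∀ t f, ‖S t f‖ ≤ M * ‖f‖) {ν : Ω → ℝ} (hν : ∀ x, 0 ≤ ν x)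
    (hνC : ∀ x, ν x ≤ C) {L : Set Ω} {δ : ℝ} (hδ : 0 < δ) {k : ℕ}
    (hL : ∀ (t : I) (f : Ω →ᵇ 𝕜), (∀ x ∈ L, f x = 0) →
      ∀ x ∈ {x | (1 / 4 : ℝ) ^ k ≤ ν x}, ‖S t f x‖ ≤ (1 / 4) ^ k * ‖f‖)
    (t : I) {g : Ω →ᵇ 𝕜} (hg : ‖g‖ ≤ 4 * (δ * 2 ^ k)) (hg0 : ∀ x ∈ L, g x = 0) (x : Ω) :
    ‖S t g x‖ * ν x ≤ 4 * (M + C) * δ / 2 ^ k := by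
  have e : (1 / 4 : ℝ) ^ k * (4 * (δ * 2 ^ k)) = 4 * δ / 2 ^ k := by
    have : (1 / 4 : ℝ) ^ k = 1 / (2 ^ k * 2 ^ k) := by
      rw [← mul_pow, div_pow, one_pow]; norm_num
    rw [this]; field_simp
  have hpos : 0 ≤ 4 * δ / 2 ^ k := by positivity
  have e' : 4 * (M + C) * δ / 2 ^ k = M * (4 * δ / 2 ^ k) + C * (4 * δ / 2 ^ k) := by ring
  rw [e']
  rcases le_or_gt ((1 / 4 : ℝ) ^ k) (ν x) with hx | hx
  · have h1 : ‖S t g x‖ ≤ 4 * δ / 2 ^ k :=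
      (hL t g hg0 x hx).trans ((mul_le_mul_of_nonneg_left hg (by positivity)).trans e.le)
    have := mul_le_mul h1 (hνC x) (hν x) hpos
    nlinarith [mul_nonneg hM hpos]
  · have h1 : ‖S t g x‖ ≤ M * (4 * (δ * 2 ^ k)) :=
      (((S t g).norm_coe_le_norm x).trans (hbd t g)).trans (mul_le_mul_of_nonneg_left hg hM)
    have := mul_le_mul h1 hx.le (hν x) (by positivity)
    rw [mul_assoc, mul_comm (4 * (δ * 2 ^ k)), e] at this
    nlinarith [mul_nonneg hC hpos]

/-- A single weight μ forces `‖f‖ ≤ δ * 2 ^ k` on every `L k`, so the layer of f between heights `δ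
* 2 ^ k` and `δ * 2 ^ (k + 1)` vanishes there. -/
theorem IsUniformlyTight.isEquicontinuousFamily [T2Space Ω]
    {S : I → (Ω →ᵇ 𝕜) →ₗ[𝕜] (Ω →ᵇ 𝕜)} (hS : IsUniformlyTight S) {M : ℝ} (hM : 0 ≤ M)
    (hbd : ∀ t f, ‖S t f‖ ≤ M * ‖f‖) : IsEquicontinuousFamily S (strictTopology Ω 𝕜) := by
  refine isEquicontinuousFamily_of_forall_exists _ _ fun ν ε hε => ?_
  obtain ⟨ν, hν, ⟨C', hC'⟩, hνc⟩ := ν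
  obtain ⟨C, hC, hνC⟩ : ∃ C : ℝ, 0 ≤ C ∧ ∀ x, ν x ≤ C :=
    ⟨max C' 0, le_max_right _ _, fun x => (hC' x).trans (le_max_left _ _)⟩
  -- The first term bounds the bottom truncation, the second the sum of all layers.
  obtain ⟨δ, hδ, hδε⟩ : ∃ δ : ℝ, 0 < δ ∧ M * δ * C + 8 * (M + C) * δ < ε := by
    have hB : 0 < M * C + 8 * (M + C) + 1 := by positivity
    refine ⟨ε / (M * C + 8 * (M + C) + 1), by positivity, ?_⟩
    rw [show ∀ d : ℝ, M * d * C + 8 * (M + C) * d = d * (M * C + 8 * (M + C)) by intro d; ring,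
      div_mul_eq_mul_div, div_lt_iff₀ hB]
    nlinarith
  choose L hLc hL using fun k : ℕ => hS _ (hνc ((1 / 4) ^ k) (by positivity)) ((1 / 4) ^ k)
    (by positivity)
  obtain ⟨μ, hμ, hμL⟩ := exists_vanishingWeight_ge L hLc hδ
  refine ⟨⟨μ, hμ⟩, 1, one_pos, fun t f hf => ?_⟩
  have hfL : ∀ k, ∀ x ∈ L k, ‖f x‖ ≤ δ * 2 ^ k := by
    intro k x hx
    have h1 : ‖f x‖ * (δ * 2 ^ k)⁻¹ ≤ 1 :=
      (mul_le_mul_of_nonneg_left (hμL k x hx) (norm_nonneg _)).trans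
        ((norm_mul_le_weightedSupSeminorm hμ.1 hμ.2.1 f (Set.mem_univ x)).trans hf.le)
    rwa [mul_inv_le_iff₀ (by positivity), one_mul] at h1
  have hr : ∀ k : ℕ, 0 ≤ δ * 2 ^ k := fun k => by positivity
  set τ : ℕ → Ω →ᵇ 𝕜 := fun k => radialTruncation (δ * 2 ^ k) (hr k) f with hτ
  -- The number of layers depends on f, but the bound on their sum does not.
  obtain ⟨n, hn⟩ : ∃ n : ℕ, ‖f‖ ≤ δ * 2 ^ n :=
    ((((tendsto_pow_atTop_atTop_of_one_lt one_lt_two).const_mul_atTop hδ).eventually_ge_atTop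
      ‖f‖)).exists
  have hτn : τ n = f := by
    ext x
    exact radialTruncation_apply_of_le _ ((f.norm_coe_le_norm x).trans hn)
  have hdec : f = ∑ k ∈ Finset.range n, (τ (k + 1) - τ k) + τ 0 := by
    rw [Finset.sum_range_sub, hτn, sub_add_cancel]
  have hlayer : ∀ k x, ‖S t (τ (k + 1) - τ k) x‖ * ν x ≤ 4 * (M + C) * δ / 2 ^ k := by
    intro k x
    refine norm_apply_mul_weight_le hM hC hbd hν hνC hδ (hL k) t ?_ (fun y hy => ?_) x
    · refine (norm_sub_le _ _).trans ((add_le_add (norm_radialTruncation_le _ _ f)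
        (norm_radialTruncation_le _ _ f)).trans ?_)
      rw [pow_succ]
      nlinarith [hr k]
    · have h1 := hfL k y hy
      have h2 : ‖f y‖ ≤ δ * 2 ^ (k + 1) := by
        rw [pow_succ]
        nlinarith [hr k]
      rw [BoundedContinuousFunction.sub_apply, radialTruncation_apply_of_le _ h2,
        radialTruncation_apply_of_le _ h1, sub_self]
  have hbase : ∀ x, ‖S t (τ 0) x‖ * ν x ≤ M * δ * C := by
    intro x
    refine mul_le_mul ?_ (hνC x) (hν x) (by positivity)
    refine (((S t _).norm_coe_le_norm x).trans (hbd t _)).trans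
      (mul_le_mul_of_nonneg_left ?_ hM)
    exact (norm_radialTruncation_le _ (hr 0) f).trans_eq (by rw [pow_zero, mul_one])
  refine (weightedSupSeminorm_le _ _ (by positivity) fun x _ => ?_).trans_lt hδε
  have hsum : ∑ k ∈ Finset.range n, ‖S t (τ (k + 1) - τ k) x‖ * ν x ≤ 8 * (M + C) * δ := by
    refine (Finset.sum_le_sum fun k _ => hlayer k x).trans ?_
    have e : ∀ k : ℕ, 4 * (M + C) * δ / 2 ^ k = 8 * (M + C) * δ / 2 / 2 ^ k := fun k => by ring
    simp only [e]
    exact (summable_geometric_two' _).sum_le_tsum _ (fun j _ => by positivity) |>.trans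
      (tsum_geometric_two' _).le
  have hle : ‖S t f x‖ ≤ ∑ k ∈ Finset.range n, ‖S t (τ (k + 1) - τ k) x‖ + ‖S t (τ 0) x‖ := by
    conv_lhs => rw [hdec, map_add, map_sum]
    rw [BoundedContinuousFunction.add_apply, BoundedContinuousFunction.sum_apply]
    exact (norm_add_le _ _).trans (add_le_add_left (norm_sum_le _ _) _)
  calc ‖S t f x‖ * ν x
      ≤ (∑ k ∈ Finset.range n, ‖S t (τ (k + 1) - τ k) x‖ + ‖S t (τ 0) x‖) * ν x :=
        mul_le_mul_of_nonneg_right hle (hν x)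
    _ = ∑ k ∈ Finset.range n, ‖S t (τ (k + 1) - τ k) x‖ * ν x + ‖S t (τ 0) x‖ * ν x := by
        rw [add_mul, Finset.sum_mul]
    _ ≤ M * δ * C + 8 * (M + C) * δ := by linarith [hbase x]

end Strict

/-! ### Bi-continuous semigroups and rescaling -/

section Semigroups

variable {Ω 𝕜 : Type*} [RCLike 𝕜] [TopologicalSpace Ω]

theorem IsBiContinuousSemigroup.isSequentiallyTight {T : ℝ≥0 → (Ω →ᵇ 𝕜) →L[𝕜] (Ω →ᵇ 𝕜)}
    (hT : IsBiContinuousSemigroup T (coTopology Ω 𝕜)) (t₀ : ℝ≥0) :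
    IsSequentiallyTight fun t : Set.Iic t₀ => (T t : (Ω →ᵇ 𝕜) →ₗ[𝕜] (Ω →ᵇ 𝕜)) := by
  intro u hu hlim K hK ε hε
  have h0 : Tendsto u atTop (@nhds _ (coTopology Ω 𝕜) 0) := by
    refine (tendsto_nhds_seminormTopology _ _ _ _).2 fun L δ hδ => ?_
    filter_upwards [hlim L L.isCompact (δ / 2) (half_pos hδ)] with n hn
    rw [sub_zero]
    exact (coSeminorms_le L (half_pos hδ).le hn).trans_lt (half_lt_self hδ)
  filter_upwards [hT.locally_biequicontinuous u 0 ⟨1, hu⟩ h0 t₀ _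
    (ball_mem_nhds_seminormTopology _ 0 ⟨K, hK⟩ hε)] with n hn t x hx
  have h1 := hn t t.2
  rw [sub_zero, Seminorm.mem_ball_zero] at h1
  exact (norm_le_coSeminorms ⟨K, hK⟩ _ hx).trans h1.le

theorem norm_rescaledFamily_apply (T : ℝ≥0 → (Ω →ᵇ 𝕜) →L[𝕜] (Ω →ᵇ 𝕜)) (α : ℝ) (t : ℝ≥0)
    (f : Ω →ᵇ 𝕜) :
    ‖rescaledFamily α (fun t => (T t : (Ω →ᵇ 𝕜) →ₗ[𝕜] (Ω →ᵇ 𝕜))) t f‖ =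
      Real.exp (-α * t) * ‖T t f‖ := by
  simp only [rescaledFamily, LinearMap.smul_apply, ContinuousLinearMap.coe_coe]
  rw [norm_smul, RCLike.norm_ofReal, Real.abs_exp]

/-- Exceeding the growth bound by 1 leaves a decaying factor, which settles large times without any
tightness. -/
theorem norm_rescaledFamily_le {T : ℝ≥0 → (Ω →ᵇ 𝕜) →L[𝕜] (Ω →ᵇ 𝕜)} {M ω : ℝ}
    (h : ∀ t : ℝ≥0, ‖T t‖ ≤ M * Real.exp (ω * t)) (t : ℝ≥0) (f : Ω →ᵇ 𝕜) :
    ‖rescaledFamily (ω + 1) (fun t => (T t : (Ω →ᵇ 𝕜) →ₗ[𝕜] (Ω →ᵇ 𝕜))) t f‖ ≤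
      M * Real.exp (-t) * ‖f‖ := by
  rw [norm_rescaledFamily_apply]
  calc Real.exp (-(ω + 1) * t) * ‖T t f‖
      ≤ Real.exp (-(ω + 1) * t) * (M * Real.exp (ω * t) * ‖f‖) :=
        mul_le_mul_of_nonneg_left ((T t).le_of_opNorm_le (h t) f) (Real.exp_pos _).le
    _ = M * (Real.exp (-(ω + 1) * t) * Real.exp (ω * t)) * ‖f‖ := by ring
    _ = M * Real.exp (-t) * ‖f‖ := by rw [← Real.exp_add]; ring_nf

/-- If a semigroup is tight on bounded time intervals then it is tight on all of `[0, ∞)` after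
rescaling. -/
theorem isUniformlyTight_rescaledFamily {T : ℝ≥0 → (Ω →ᵇ 𝕜) →L[𝕜] (Ω →ᵇ 𝕜)} {M ω : ℝ}
    (h : ∀ t : ℝ≥0, ‖T t‖ ≤ M * Real.exp (ω * t))
    (hloc : ∀ t₀ : ℝ≥0,
      IsUniformlyTight fun t : Set.Iic t₀ => (T t : (Ω →ᵇ 𝕜) →ₗ[𝕜] (Ω →ᵇ 𝕜))) :
    IsUniformlyTight
      (rescaledFamily (ω + 1) fun t => (T t : (Ω →ᵇ 𝕜) →ₗ[𝕜] (Ω →ᵇ 𝕜))) := by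
  intro K hK ε hε
  obtain ⟨t₀, ht₀⟩ : ∃ t₀ : ℝ≥0, ∀ t : ℝ≥0, t₀ ≤ t → M * Real.exp (-t) ≤ ε := by
    have h1 : Tendsto (fun t : ℝ => M * Real.exp (-t)) atTop (𝓝 0) := by
      simpa using (Real.tendsto_exp_neg_atTop_nhds_zero).const_mul M
    obtain ⟨a, ha⟩ := (eventually_atTop.1 (h1.eventually_le_const hε))
    exact ⟨a.toNNReal, fun t ht => ha t (Real.toNNReal_le_iff_le_coe.1 ht)⟩
  have hE : 0 < Real.exp (|ω + 1| * t₀) := Real.exp_pos _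
  -- The divisor is the largest the rescaling factor can be on `[0, t₀]`, whatever the sign of `ω +
  -- 1`.
  obtain ⟨L, hL, hLT⟩ := hloc t₀ K hK (ε / Real.exp (|ω + 1| * t₀)) (by positivity)
  refine ⟨L, hL, fun t f hf x hx => ?_⟩
  rcases le_total t t₀ with ht | ht
  · have h1 : ‖T t f x‖ ≤ ε / Real.exp (|ω + 1| * t₀) * ‖f‖ := hLT ⟨t, ht⟩ f hf x hx
    have h2 : Real.exp (-(ω + 1) * t) ≤ Real.exp (|ω + 1| * t₀) :=
      Real.exp_le_exp.2 (mul_le_mul (neg_le_abs _) (NNReal.coe_le_coe.2 ht) t.2 (abs_nonneg _))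
    have e : ‖rescaledFamily (ω + 1) (fun t => (T t : (Ω →ᵇ 𝕜) →ₗ[𝕜] (Ω →ᵇ 𝕜))) t f x‖ =
        Real.exp (-(ω + 1) * t) * ‖T t f x‖ := by
      simp only [rescaledFamily, LinearMap.smul_apply, ContinuousLinearMap.coe_coe,
        BoundedContinuousFunction.smul_apply]
      rw [norm_smul, RCLike.norm_ofReal, Real.abs_exp]
    rw [e]
    calc _ ≤ Real.exp (|ω + 1| * t₀) * (ε / Real.exp (|ω + 1| * t₀) * ‖f‖) :=
          mul_le_mul h2 h1 (norm_nonneg _) hE.le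
      _ = ε * ‖f‖ := by field_simp
  · exact (norm_coe_le_norm _ x).trans ((norm_rescaledFamily_le h t f).trans
      (mul_le_mul_of_nonneg_right (ht₀ t ht) (norm_nonneg f)))

end Semigroups

/-! ### The main theorem -/

theorem theorem4p1 {Ω 𝕜 : Type*} [RCLike 𝕜] [TopologicalSpace Ω] [T2Space Ω]
    (hΩ : IsKRSpace Ω) (h : IsHemicompact Ω ∨ PolishSpace Ω)
    (T : ℝ≥0 → (Ω →ᵇ 𝕜) →L[𝕜] (Ω →ᵇ 𝕜))
    (hT : IsBiContinuousSemigroup T (coTopology Ω 𝕜)) :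
    IsQuasiEquicontinuous (fun t => (T t : (Ω →ᵇ 𝕜) →ₗ[𝕜] (Ω →ᵇ 𝕜)))
        (strictTopology Ω 𝕜) ∧
      IsQuasiEquitight (coSeminorms Ω 𝕜)
        (fun t => (T t : (Ω →ᵇ 𝕜) →ₗ[𝕜] (Ω →ᵇ 𝕜))) := by
  obtain ⟨M, hM, ω, hMω⟩ := hT.exp_bounded
  have hM0 : 0 ≤ M := zero_le_one.trans hM
  have hloc : ∀ t₀ : ℝ≥0,
      IsUniformlyTight fun t : Set.Iic t₀ => (T t : (Ω →ᵇ 𝕜) →ₗ[𝕜] (Ω →ᵇ 𝕜)) := by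
    intro t₀
    rcases h with h | h
    · exact (hT.isSequentiallyTight t₀).isUniformlyTight_of_isHemicompact h
    · refine (hT.isSequentiallyTight t₀).isUniformlyTight_of_polishSpace
        (M := M * Real.exp (|ω| * t₀)) (by positivity) fun t f => ?_
      refine (T t).le_of_opNorm_le ((hMω t).trans (mul_le_mul_of_nonneg_left ?_ hM0)) f
      exact Real.exp_le_exp.2 (mul_le_mul (le_abs_self _) (NNReal.coe_le_coe.2 t.2) t.1.2
        (abs_nonneg _))
  have htight := isUniformlyTight_rescaledFamily hMω hloc
  have hbd : ∀ (t : ℝ≥0) (f : Ω →ᵇ 𝕜),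
      ‖rescaledFamily (ω + 1) (fun t => (T t : (Ω →ᵇ 𝕜) →ₗ[𝕜] (Ω →ᵇ 𝕜))) t f‖ ≤ M * ‖f‖ := by
    intro t f
    refine (norm_rescaledFamily_le hMω t f).trans
      (mul_le_mul_of_nonneg_right (mul_le_of_le_one_right hM0 ?_) (norm_nonneg f))
    exact Real.exp_le_one_iff.2 (neg_nonpos.2 t.2)
  exact ⟨⟨ω + 1, htight.isEquicontinuousFamily hM0 hbd⟩, ⟨ω + 1, htight.isEquitight hM0 hbd⟩⟩
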